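/- Theorem 1. A polygonal knot is a simple closed polygon in $\mathbb{R}^3$ (at least three edges; consecutive edges may be collinear), and two polygonal knots have the same knot type if they are related by finitely many triangle moves ($\Delta$-moves) and their inverses, where a triangle move replaces a straight segment $ab$ of the polygon by the two other sides $ac \cup cb$ of a nondegenerate triangle $abc$ which meets the polygon exactly in $ab$. (For polygonal knots this is the same as ambient isotopy.) As usual in knot tables, a knot is not distinguished from its mirror image or its reverse. The stick number of a knot $K$ is the minimal number of edges of a polygonal knot realizing $K$; the equilateral stick number is the minimal number of edges of a polygonal knot realizing $K$ all of whose edges have the same length. The following statements hold for the knots of the standard (Rolfsen) table, which are identified here by Dowker–Thistlethwaite codes of minimal diagrams. The knots - $9_{18}$, with code $[4, 12, 14, 18, 16, 2, 10, 6, 8]$, - $10_{18}$, with code $[4, 12, 20, 18, 16, 2, 6, 10, 8, 14]$, - $10_{68}$, with code $[4, 12, 16, 14, 18, 2, 20, 6, 10, 8]$, - $10_{82}$, with code $[6, 8, 14, 16, 4, 18, 20, 2, 10, 12]$, - $10_{84}$, with code $[4, 10, 16, 14, 2, 8, 18, 20, 12, 6]$, - $10_{93}$, with code $[6, 10, 16,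 20, 14, 4, 18, 2, 12, 8]$, - $10_{100}$, with code $[6, 10, 18, 14, 16, 4, 20, 8, 2, 12]$, - $10_{152}$, with code $[6, 8, 12, 2, -16, 4, -18, -20, -10, -14]$, have stick number at most $10$ and equilateral stick number at most $10$. The knots - $10_{58}$, with code $[4, 8, 14, 10, 2, 18, 6, 20, 12, 16]$, - $10_{66}$, with code $[4, 10, 16, 18, 2, 14, 20, 8, 6, 12]$, - $10_{79}$, with code $[6, 8, 12, 2, 16, 4, 18, 20, 10, 14]$, - $10_{80}$, with code $[4, 8, 18, 2, 14, 16, 20, 10, 6, 12]$, have stick number at most $11$ and equilateral stick number at most $11$. Here a code $[c_1, \dots, c_k]$ describes a diagram with $k$ crossings as follows: going once around the knot, the passages through crossings are numbered $1, \dots, 2k$; passage $2r-1$ meets passage $|c_r|$, and passage $2r-1$ is the upper one if $c_r > 0$ and the lower one if $c_r < 0$. -/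

import Mathlib

namespace StickKnot

/-- Euclidean three-space. -/
abbrev Space := EuclideanSpace ℝ (Fin 3)

/-- The point with parameter `t` on the `i`-th edge of the closed polygon with cyclically ordered
vertices `v 0, …, v (n - 1)`; this edge runs from `v i` (at `t = 0`) to the next vertex
(at `t = 1`), and the successor of the last vertex is the first one. -/
noncomputable def polygonPoint {n : ℕ} (v : Fin n → Space) (i : Fin n) (t : ℝ) : Space :=
  AffineMap.lineMap (v i) (v (finRotate n i)) t

/-- A polygonal knot: a closed polygon in space without self-intersections, given by its vertices
in cyclic order. -/
structure PolygonalKnot where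
  /-- the number of edges (equivalently, of vertices) -/
  edges : ℕ
  three_le : 3 ≤ edges
  /-- the vertices, in cyclic order -/
  vertex : Fin edges → Space
  /-- going once around the polygon, no point is visited twice -/
  simple : ∀ (i j : Fin edges) (s t : ℝ), s ∈ Set.Ico (0 : ℝ) 1 → t ∈ Set.Ico (0 : ℝ) 1 →
    polygonPoint vertex i s = polygonPoint vertex j t → i = j ∧ s = t

namespace PolygonalKnot

/-- The closed polygonal curve, as a subset of space. -/
def curve (K : PolygonalKnot) : Set Space :=
  ⋃ i : Fin K.edges, segment ℝ (K.vertex i) (K.vertex (finRotate K.edges i))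

/-- All edges of the polygon have the same length. -/
def IsEquilateral (K : PolygonalKnot) : Prop :=
  ∃ l : ℝ, ∀ i : Fin K.edges, dist (K.vertex i) (K.vertex (finRotate K.edges i)) = l

end PolygonalKnot

/-- An elementary deformation (`Δ`-move) of polygonal curves: if a nondegenerate triangle `abc`
meets the curve `C` exactly in the side `ab`, then this side is replaced by the union of the two
other sides `ac` and `cb`. -/
def ElementaryMove (C C' : Set Space) : Prop :=
  ∃ a b c : Space, AffineIndependent ℝ ![a, b, c] ∧
    convexHull ℝ {a, b, c} ∩ C = segment ℝ a b ∧
    C' = (C \ segment ℝ a b) ∪ segment ℝ a c ∪ segment ℝ c b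

namespace PolygonalKnot

/-- Two polygonal knots are equivalent if finitely many elementary deformations and inverses of
elementary deformations transform one curve into the other. -/
def Equivalent (K L : PolygonalKnot) : Prop :=
  Relation.EqvGen ElementaryMove K.curve L.curve

/-- The vertical projection of space to the plane of the first two coordinates. -/
def shadow (x : Space) : ℝ × ℝ := (x 0, x 1)

/-- The vertical projection of `K` is a regular knot diagram with Dowker–Thistlethwaite code `c`.

Going once around the knot, the passages through crossings are labelled `1, 2, …, 2k`, where `k` is
the length of `c`; passage number `l` happens at the interior point `p l` (edge, parameter) of an
edge. The double points of the projection are exactly the `k` crossings, in which the passage with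
the `r`-th odd number meets the passage with number `|c r|`. The entry `c r` is positive if the
passage with the odd number is the upper one, and negative if it is the lower one. -/
def HasDTCode (K : PolygonalKnot) (c : List ℤ) : Prop :=
  ∃ p : ℕ → Fin K.edges × ℝ,
    (∀ l ∈ Set.Icc 1 (2 * c.length), (p l).2 ∈ Set.Ioo (0 : ℝ) 1) ∧
    StrictMonoOn (fun l => (((p l).1 : ℕ) : ℝ) + (p l).2) (Set.Icc 1 (2 * c.length)) ∧
    (∀ (i j : Fin K.edges) (s t : ℝ), s ∈ Set.Ico (0 : ℝ) 1 → t ∈ Set.Ico (0 : ℝ) 1 →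
      (i, s) ≠ (j, t) →
      (shadow (polygonPoint K.vertex i s) = shadow (polygonPoint K.vertex j t) ↔
        ∃ r : Fin c.length, s((i, s), (j, t)) = s(p (2 * r + 1), p (c.get r).natAbs))) ∧
    ∀ r : Fin c.length,
      let odd : Space := polygonPoint K.vertex (p (2 * r + 1)).1 (p (2 * r + 1)).2
      let even : Space := polygonPoint K.vertex (p (c.get r).natAbs).1 (p (c.get r).natAbs).2
      if 0 < c.get r then even 2 < odd 2 else odd 2 < even 2

end PolygonalKnot

/-- A knot type, given by the set of all polygonal knots that realize it. -/
abbrev KnotType := Set PolygonalKnot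

/-- The knot with Dowker–Thistlethwaite code `c`. As usual in knot tables, a knot and its mirror
image (and its reverse) are not distinguished; up to this, the code of a prime knot determines
it. -/
def knotOfDTCode (c : List ℤ) : KnotType :=
  {K | ∃ L : PolygonalKnot, K.Equivalent L ∧ L.HasDTCode c}

/-- The stick number: the minimal number of edges of a polygonal realization
(and `⊤` if there is none). -/
noncomputable def stickNumber (T : KnotType) : ℕ∞ :=
  ⨅ K ∈ T, (K.edges : ℕ∞)

/-- The equilateral stick number: the minimal number of edges of a polygonal realization all of
whose edges have the same length (and `⊤` if there is none). -/
noncomputable def eqStickNumber (T : KnotType) : ℕ∞ :=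
  ⨅ K ∈ {K ∈ T | K.IsEquilateral}, (K.edges : ℕ∞)

/-! The knots of the standard table (Rolfsen's numbering), by their Dowker–Thistlethwaite codes. -/

def knot_9_18 : KnotType := knotOfDTCode [4, 12, 14, 18, 16, 2, 10, 6, 8]

def knot_10_18 : KnotType := knotOfDTCode [4, 12, 20, 18, 16, 2, 6, 10, 8, 14]

def knot_10_58 : KnotType := knotOfDTCode [4, 8, 14, 10, 2, 18, 6, 20, 12, 16]

def knot_10_66 : KnotType := knotOfDTCode [4, 10, 16, 18, 2, 14, 20, 8, 6, 12]

def knot_10_68 : KnotType := knotOfDTCode [4, 12, 16, 14, 18, 2, 20, 6, 10, 8]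

def knot_10_79 : KnotType := knotOfDTCode [6, 8, 12, 2, 16, 4, 18, 20, 10, 14]

def knot_10_80 : KnotType := knotOfDTCode [4, 8, 18, 2, 14, 16, 20, 10, 6, 12]

def knot_10_82 : KnotType := knotOfDTCode [6, 8, 14, 16, 4, 18, 20, 2, 10, 12]

def knot_10_84 : KnotType := knotOfDTCode [4, 10, 16, 14, 2, 8, 18, 20, 12, 6]

def knot_10_93 : KnotType := knotOfDTCode [6, 10, 16, 20, 14, 4, 18, 2, 12, 8]

def knot_10_100 : KnotType := knotOfDTCode [6, 10, 18, 14, 16, 4, 20, 8, 2, 12]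

def knot_10_152 : KnotType := knotOfDTCode [6, 8, 12, 2, -16, 4, -18, -20, -10, -14]

end StickKnot

namespace StickKnot


/-! Upper bounds for stick numbers need only examples: one equilateral polygon with 10 or 11 edges
for each knot bounds both invariants at once. All vertices are integral, so equality of edge lengths
is exact and every geometric condition becomes a sign condition on integer polynomials, which the
kernel evaluates.

Two things have to be certified. The knot type is read off from a vertical projection: shadows of
edges cross where Cramer's rule says, and the order of crossings along the knot and their heights
are compared after clearing denominators (`SimpleShadow.simple`, `IntegralDTCode.hasDTCode`). If the
projection of the short polygon does not show the required code, a list of moves leads to a polygon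
that does. Each move inserts a vertex into the closing edge or undoes such an insertion; signs of
tetrahedron volumes show that the triangle involved meets the rest of the polygon in no further
point (`CanInsert.elementaryMove`, `eqvGen_of_runSteps`). `stickNumber_le_of_lattice` combines both,
and the rest is data. -/

/-- A point of space with integer coordinates. -/
abbrev LatticePoint := ℤ × ℤ × ℤ

/-- The point of Euclidean space with the given integer coordinates. -/
noncomputable def LatticePoint.toSpace (p : LatticePoint) : Space := !₂[(p.1 : ℝ), p.2.1, p.2.2]

/-! ### Knot diagrams of lattice polygons in integer arithmetic. -/

section Diagram

variable {n : ℕ} (w : Fin n → LatticePoint)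

/-- The difference of the end points of the `i`-th edge. -/
def edgeVec (i : Fin n) : LatticePoint := w (finRotate n i) - w i

/-- The determinant of the directions of the shadows of two edges. -/
def shadowDet (i j : Fin n) : ℤ :=
  (edgeVec w i).1 * (edgeVec w j).2.1 - (edgeVec w i).2.1 * (edgeVec w j).1

/-- The numerator of the parameter on the `i`-th edge of the point where the lines spanned by the
shadows of the `i`-th and the `j`-th edge meet; the denominator is `shadowDet w i j`. -/
def shadowNum (i j : Fin n) : ℤ :=
  ((w j).1 - (w i).1) * (edgeVec w j).2.1 - ((w j).2.1 - (w i).2.1) * (edgeVec w j).1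

/-- The parameter on the `i`-th edge of its crossing with the `j`-th edge. -/
noncomputable def crossingParam (i j : Fin n) : ℝ := shadowNum w i j / shadowDet w i j

/-- The height of the `i`-th edge above its crossing with the `j`-th edge, multiplied by the square
of `shadowDet w i j`. -/
def scaledHeight (i j : Fin n) : ℤ :=
  (w i).2.2 * (shadowDet w i j * shadowDet w i j) +
    shadowNum w i j * shadowDet w i j * (edgeVec w i).2.2

/-- The parameter at which the `i`-th edge meets the line of the `j`-th edge in the shadow is not
in `[0, 1)`. -/
def Misses (i j : Fin n) : Prop :=
  shadowNum w i j * shadowDet w i j < 0 ∨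
    shadowDet w i j * shadowDet w i j ≤ shadowNum w i j * shadowDet w i j

instance (i j : Fin n) : Decidable (Misses w i j) := by unfold Misses; infer_instance

/-- No two edges have parallel shadows, and where the shadows of two edges cross, the heights
differ. -/
def SimpleShadow : Prop :=
  ∀ i j : Fin n, i ≠ j → shadowDet w i j ≠ 0 ∧
    (Misses w i j ∨ Misses w j i ∨ scaledHeight w i j ≠ scaledHeight w j i)

instance : Decidable (SimpleShadow w) := by unfold SimpleShadow; infer_instance

/-- The integral form of `PolygonalKnot.HasDTCode`; the passage with number `l` is on the edge
`(e l).1` and crosses the edge `(e l).2`. -/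
def IntegralDTCode (c : List ℤ) (e : ℕ → Fin n × Fin n) : Prop :=
  (∀ l ∈ Finset.Icc 1 (2 * c.length), (e l).1 ≠ (e l).2 ∧ ¬ Misses w (e l).1 (e l).2 ∧
    shadowNum w (e l).1 (e l).2 ≠ 0) ∧
  (∀ l ∈ Finset.Ico 1 (2 * c.length), (e l).1 < (e (l + 1)).1 ∨ (e l).1 = (e (l + 1)).1 ∧
    shadowNum w (e l).1 (e l).2 * shadowDet w (e l).1 (e l).2 *
        (shadowDet w (e (l + 1)).1 (e (l + 1)).2 * shadowDet w (e (l + 1)).1 (e (l + 1)).2) <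
      shadowNum w (e (l + 1)).1 (e (l + 1)).2 * shadowDet w (e (l + 1)).1 (e (l + 1)).2 *
        (shadowDet w (e l).1 (e l).2 * shadowDet w (e l).1 (e l).2)) ∧
  (∀ i j : Fin n, i ≠ j → Misses w i j ∨ Misses w j i ∨
    ∃ r : Fin c.length, e (2 * r + 1) = (i, j) ∨ e (2 * r + 1) = (j, i)) ∧
  ∀ r : Fin c.length, (c.get r).natAbs ∈ Finset.Icc 1 (2 * c.length) ∧
    e (c.get r).natAbs = (e (2 * r + 1)).swap ∧
    if 0 < c.get r then
      scaledHeight w (e (2 * r + 1)).2 (e (2 * r + 1)).1 <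
        scaledHeight w (e (2 * r + 1)).1 (e (2 * r + 1)).2
    else
      scaledHeight w (e (2 * r + 1)).1 (e (2 * r + 1)).2 <
        scaledHeight w (e (2 * r + 1)).2 (e (2 * r + 1)).1

instance (c : List ℤ) (e : ℕ → Fin n × Fin n) : Decidable (IntegralDTCode w c e) := by
  unfold IntegralDTCode; infer_instance

/-- The squares of the lengths of all edges are equal to `q`. -/
def HasSqLength (q : ℤ) : Prop :=
  ∀ i : Fin n, (edgeVec w i).1 ^ 2 + (edgeVec w i).2.1 ^ 2 + (edgeVec w i).2.2 ^ 2 = q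

instance (q : ℤ) : Decidable (HasSqLength w q) := by unfold HasSqLength; infer_instance

variable {w}

lemma shadowDet_swap (i j : Fin n) : shadowDet w j i = -shadowDet w i j := by
  unfold shadowDet; ring

lemma polygonPoint_apply_zero (i : Fin n) (s : ℝ) :
    polygonPoint (fun i => (w i).toSpace) i s 0 = (w i).1 + s * (edgeVec w i).1 := by
  simp [polygonPoint, AffineMap.lineMap_apply, LatticePoint.toSpace, edgeVec]; ring

lemma polygonPoint_apply_one (i : Fin n) (s : ℝ) :
    polygonPoint (fun i => (w i).toSpace) i s 1 = (w i).2.1 + s * (edgeVec w i).2.1 := by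
  simp [polygonPoint, AffineMap.lineMap_apply, LatticePoint.toSpace, edgeVec]; ring

lemma polygonPoint_apply_two (i : Fin n) (s : ℝ) :
    polygonPoint (fun i => (w i).toSpace) i s 2 = (w i).2.2 + s * (edgeVec w i).2.2 := by
  simp [polygonPoint, AffineMap.lineMap_apply, LatticePoint.toSpace, edgeVec]; ring

lemma shadow_eq_iff (i j : Fin n) (s t : ℝ) :
    PolygonalKnot.shadow (polygonPoint (fun i => (w i).toSpace) i s) =
        PolygonalKnot.shadow (polygonPoint (fun i => (w i).toSpace) j t) ↔
      ((w i).1 : ℝ) + s * (edgeVec w i).1 = (w j).1 + t * (edgeVec w j).1 ∧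
        ((w i).2.1 : ℝ) + s * (edgeVec w i).2.1 = (w j).2.1 + t * (edgeVec w j).2.1 := by
  simp only [PolygonalKnot.shadow, Prod.mk.injEq, polygonPoint_apply_zero, polygonPoint_apply_one]

/-- Cramer's rule for the two linear equations in `s` and `t`. -/
lemma param_eq_of_shadow_eq {i j : Fin n} {s t : ℝ} (h0 : shadowDet w i j ≠ 0)
    (h : PolygonalKnot.shadow (polygonPoint (fun i => (w i).toSpace) i s) =
      PolygonalKnot.shadow (polygonPoint (fun i => (w i).toSpace) j t)) :
    s = crossingParam w i j := by
  obtain ⟨hx, hy⟩ := (shadow_eq_iff i j s t).1 h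
  have h0' : (shadowDet w i j : ℝ) ≠ 0 := by exact_mod_cast h0
  rw [crossingParam, eq_div_iff h0']
  simp only [shadowDet, shadowNum]
  push_cast
  linear_combination ((edgeVec w j).2.1 : ℝ) * hx - ((edgeVec w j).1 : ℝ) * hy

lemma shadow_eq_of_crossingParam {i j : Fin n} (h0 : shadowDet w i j ≠ 0) :
    PolygonalKnot.shadow (polygonPoint (fun i => (w i).toSpace) i (crossingParam w i j)) =
      PolygonalKnot.shadow (polygonPoint (fun i => (w i).toSpace) j (crossingParam w j i)) := by
  have h0' : (shadowDet w i j : ℝ) ≠ 0 := by exact_mod_cast h0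
  rw [shadow_eq_iff, crossingParam, crossingParam, shadowDet_swap i j]
  push_cast
  constructor <;> field_simp <;> simp only [shadowDet, shadowNum] <;> push_cast <;> ring

/-- Scaling by the square of the determinant, not by the determinant itself, preserves inequalities
whatever its sign. Hence the products `shadowNum * shadowDet` in all the integral conditions. -/
lemma crossingParam_mul_sq {i j : Fin n} (h0 : shadowDet w i j ≠ 0) :
    crossingParam w i j * ((shadowDet w i j : ℝ) * shadowDet w i j) =
      shadowNum w i j * shadowDet w i j := by
  have h0' : (shadowDet w i j : ℝ) ≠ 0 := by exact_mod_cast h0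
  rw [crossingParam]; field_simp

lemma shadowDet_mul_self_pos {i j : Fin n} (h0 : shadowDet w i j ≠ 0) :
    (0 : ℝ) < (shadowDet w i j : ℝ) * shadowDet w i j := by
  have h0' : (shadowDet w i j : ℝ) ≠ 0 := by exact_mod_cast h0
  exact mul_self_pos.2 h0'

lemma misses_iff {i j : Fin n} (h0 : shadowDet w i j ≠ 0) :
    Misses w i j ↔ crossingParam w i j ∉ Set.Ico (0 : ℝ) 1 := by
  have h1 := crossingParam_mul_sq h0
  have h2 := shadowDet_mul_self_pos h0
  have h3 : shadowNum w i j * shadowDet w i j < 0 ↔ crossingParam w i j < 0 := by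
    rw [← Int.cast_lt (R := ℝ)]
    push_cast
    rw [← h1]
    refine ⟨fun h => ?_, fun h => mul_neg_of_neg_of_pos h h2⟩
    by_contra! h'
    exact absurd h (not_lt.2 (mul_nonneg h' h2.le))
  have h4 : shadowDet w i j * shadowDet w i j ≤ shadowNum w i j * shadowDet w i j ↔
      1 ≤ crossingParam w i j := by
    rw [← Int.cast_le (R := ℝ)]
    push_cast
    rw [← h1, le_mul_iff_one_le_left h2]
  rw [Misses, h3, h4, Set.mem_Ico, not_and_or, not_le, not_lt]

lemma height_mul_sq {i j : Fin n} (h0 : shadowDet w i j ≠ 0) :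
    polygonPoint (fun i => (w i).toSpace) i (crossingParam w i j) 2 *
      ((shadowDet w i j : ℝ) * shadowDet w i j) = scaledHeight w i j := by
  rw [polygonPoint_apply_two, add_mul, mul_right_comm, crossingParam_mul_sq h0, scaledHeight]
  push_cast; ring

/-- Exchanging the edges only changes the sign of the determinant, so both scaled heights carry the
same positive factor. -/
lemma height_lt_height_iff {i j : Fin n} (h0 : shadowDet w i j ≠ 0) :
    polygonPoint (fun i => (w i).toSpace) i (crossingParam w i j) 2 <
        polygonPoint (fun i => (w i).toSpace) j (crossingParam w j i) 2 ↔
      scaledHeight w i j < scaledHeight w j i := by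
  have h0' : shadowDet w j i ≠ 0 := by rw [shadowDet_swap]; exact neg_ne_zero.2 h0
  have h1 := height_mul_sq h0
  have h2 := height_mul_sq h0'
  rw [shadowDet_swap i j] at h2
  push_cast at h2
  rw [neg_mul_neg] at h2
  rw [← Int.cast_lt (R := ℝ), ← h1, ← h2, mul_lt_mul_iff_left₀ (shadowDet_mul_self_pos h0)]

lemma edge_param_injective {i : Fin n} {s t : ℝ}
    (h0 : (edgeVec w i).1 ≠ 0 ∨ (edgeVec w i).2.1 ≠ 0)
    (h : PolygonalKnot.shadow (polygonPoint (fun i => (w i).toSpace) i s) =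
      PolygonalKnot.shadow (polygonPoint (fun i => (w i).toSpace) i t)) : s = t := by
  obtain ⟨hx, hy⟩ := (shadow_eq_iff i i s t).1 h
  rcases h0 with h0 | h0
  · have h0' : ((edgeVec w i).1 : ℝ) ≠ 0 := by exact_mod_cast h0
    exact mul_right_cancel₀ h0' (add_left_cancel hx)
  · have h0' : ((edgeVec w i).2.1 : ℝ) ≠ 0 := by exact_mod_cast h0
    exact mul_right_cancel₀ h0' (add_left_cancel hy)

lemma SimpleShadow.edgeVec_ne_zero (h : SimpleShadow w) (hn : 3 ≤ n) (i : Fin n) :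
    (edgeVec w i).1 ≠ 0 ∨ (edgeVec w i).2.1 ≠ 0 := by
  have : Nontrivial (Fin n) := Fin.nontrivial_iff_two_le.2 (by omega)
  obtain ⟨j, hj⟩ := exists_ne i
  by_contra! h0
  exact (h i j hj.symm).1 (by simp [shadowDet, h0.1, h0.2])

/-- Distinct edges have at most one common shadow point, and there either the parameter leaves `[0,
1)` on one edge or the heights differ. Consecutive edges are no exception: their common vertex has
parameter 1 on the first of them. -/
lemma SimpleShadow.simple (h : SimpleShadow w) (hn : 3 ≤ n) (i j : Fin n) (s t : ℝ)
    (hs : s ∈ Set.Ico (0 : ℝ) 1) (ht : t ∈ Set.Ico (0 : ℝ) 1)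
    (hst : polygonPoint (fun i => (w i).toSpace) i s = polygonPoint (fun i => (w i).toSpace) j t) :
    i = j ∧ s = t := by
  have hsh := congrArg PolygonalKnot.shadow hst
  by_cases hij : i = j
  · subst hij
    exact ⟨rfl, edge_param_injective (h.edgeVec_ne_zero hn i) hsh⟩
  · exfalso
    obtain ⟨h0, hm⟩ := h i j hij
    have h0' := (h j i (Ne.symm hij)).1
    have e1 := param_eq_of_shadow_eq h0 hsh
    have e2 := param_eq_of_shadow_eq h0' hsh.symm
    subst e1 e2
    rw [misses_iff h0, misses_iff h0'] at hm
    rcases hm with hm | hm | hm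
    · exact hm hs
    · exact hm ht
    · rcases lt_or_gt_of_ne hm with hm | hm
      · exact ((height_lt_height_iff h0).2 hm).ne (congrArg (fun x : Space => x 2) hst)
      · exact ((height_lt_height_iff h0').2 hm).ne (congrArg (fun x : Space => x 2) hst.symm)

/-- The polygonal knot with the given integral vertices. -/
noncomputable def latticeKnot (w : Fin n → LatticePoint) (hn : 3 ≤ n) (h : SimpleShadow w) :
    PolygonalKnot where
  edges := n
  three_le := hn
  vertex i := (w i).toSpace
  simple := h.simple hn

lemma latticeKnot_isEquilateral {q : ℤ} (hn : 3 ≤ n) (h : SimpleShadow w) (hq : HasSqLength w q) :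
    (latticeKnot w hn h).IsEquilateral := by
  refine ⟨√q, fun i => ?_⟩
  change dist (w i).toSpace (w (finRotate n i)).toSpace = √q
  rw [← hq i, EuclideanSpace.dist_eq]
  congr 1
  simp only [LatticePoint.toSpace, Fin.sum_univ_three, Real.dist_eq, sq_abs, edgeVec]
  simp
  ring

lemma IntegralDTCode.hasDTCode {c : List ℤ} {e : ℕ → Fin n × Fin n} (hn : 3 ≤ n)
    (h : SimpleShadow w) (hc : IntegralDTCode w c e) : (latticeKnot w hn h).HasDTCode c := by
  obtain ⟨h1, h2, h3, h4⟩ := hc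
  have hmem : ∀ r : Fin c.length, 2 * (r : ℕ) + 1 ∈ Finset.Icc 1 (2 * c.length) := fun r => by
    rw [Finset.mem_Icc]; omega
  have hodd : ∀ r : Fin c.length,
      shadowDet w (e (2 * r + 1)).1 (e (2 * r + 1)).2 ≠ 0 := fun r => (h _ _ (h1 _ (hmem r)).1).1
  have hparam : ∀ l ∈ Finset.Icc 1 (2 * c.length),
      crossingParam w (e l).1 (e l).2 ∈ Set.Ioo (0 : ℝ) 1 := by
    intro l hl
    obtain ⟨hne, hm, hz⟩ := h1 l hl
    have h0 := (h _ _ hne).1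
    rw [misses_iff h0, not_not] at hm
    -- `Misses` only excludes the complement of `[0, 1)`; the nonzero numerator keeps the crossing
    -- away from the initial vertex.
    refine ⟨lt_of_le_of_ne hm.1 ?_, hm.2⟩
    rw [crossingParam, ne_comm]
    exact div_ne_zero (by exact_mod_cast hz) (by exact_mod_cast h0)
  refine ⟨fun l => ((e l).1, crossingParam w (e l).1 (e l).2), ?_, ?_, ?_, ?_⟩
  · intro l hl
    exact hparam l (by simpa using hl)
  -- Consecutive labels suffice. On different edges the edge index grows by at least 1, which
  -- outweighs parameters in `(0, 1)`; on the same edge the two fractions are compared by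
  -- cross-multiplication.
  · refine strictMonoOn_of_lt_add_one Set.ordConnected_Icc fun l _ hl hl' => ?_
    have hl1 := hparam l (by simpa using hl)
    have hl2 := hparam (l + 1) (by simpa using hl')
    have hne := (h1 l (by simpa using hl)).1
    have hne' := (h1 (l + 1) (by simpa using hl')).1
    rw [Set.mem_Icc] at hl hl'
    rcases h2 l (by rw [Finset.mem_Ico]; omega) with hlt | ⟨heq, hlt⟩
    · have : (((e l).1 : ℕ) : ℝ) + 1 ≤ ((e (l + 1)).1 : ℕ) := by exact_mod_cast hlt
      simp only
      linarith [hl1.2, hl2.1]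
    · have h0 := (h _ _ hne).1
      have h0' := (h _ _ hne').1
      rw [← Int.cast_lt (R := ℝ)] at hlt
      push_cast at hlt
      rw [← crossingParam_mul_sq h0, ← crossingParam_mul_sq h0'] at hlt
      have hsq := mul_pos (shadowDet_mul_self_pos h0) (shadowDet_mul_self_pos h0')
      have hpar : crossingParam w (e l).1 (e l).2 <
          crossingParam w (e (l + 1)).1 (e (l + 1)).2 :=
        lt_of_mul_lt_mul_right (by linarith) hsq.le
      have : (((e l).1 : ℕ) : ℝ) = ((e (l + 1)).1 : ℕ) := by rw [heq]
      simp only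
      linarith
  · intro i j s t hs ht hne
    constructor
    · intro hsh
      have hij : i ≠ j := by
        rintro rfl
        exact hne (by rw [edge_param_injective (h.edgeVec_ne_zero hn i) hsh])
      have h0 := (h i j hij).1
      have h0' := (h j i hij.symm).1
      have e1 := param_eq_of_shadow_eq h0 hsh
      have e2 := param_eq_of_shadow_eq h0' hsh.symm
      subst e1 e2
      rcases h3 i j hij with hm | hm | ⟨r, hr⟩
      · exact absurd hs ((misses_iff h0).1 hm)
      · exact absurd ht ((misses_iff h0').1 hm)
      · refine ⟨r, ?_⟩
        -- The passage with the even label carries the same two edges in the other order, so the odd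
        -- label determines the crossing.
        simp only [(h4 r).2.1, Prod.fst_swap, Prod.snd_swap]
        rcases hr with hr | hr
        · rw [hr]
        · rw [hr]; exact Sym2.eq_swap
    · rintro ⟨r, hr⟩
      simp only [(h4 r).2.1, Prod.fst_swap, Prod.snd_swap] at hr
      have key := shadow_eq_of_crossingParam (hodd r)
      rcases Sym2.eq_iff.1 hr with ⟨ha, hb⟩ | ⟨ha, hb⟩
      · obtain ⟨rfl, rfl⟩ := Prod.mk.inj ha
        obtain ⟨rfl, rfl⟩ := Prod.mk.inj hb
        exact key
      · obtain ⟨rfl, rfl⟩ := Prod.mk.inj ha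
        obtain ⟨rfl, rfl⟩ := Prod.mk.inj hb
        exact key.symm
  · intro r
    have h5 := (h4 r).2.2
    have h0 := hodd r
    have h0' : shadowDet w (e (2 * r + 1)).2 (e (2 * r + 1)).1 ≠ 0 := by
      rw [shadowDet_swap]; exact neg_ne_zero.2 h0
    simp only [(h4 r).2.1, Prod.fst_swap, Prod.snd_swap]
    split_ifs at h5 ⊢
    · exact (height_lt_height_iff h0').2 h5
    · exact (height_lt_height_iff h0).2 h5

end Diagram


/-! ### Polygonal curves given by lists of vertices. -/

section PathCurve

/-- The polygonal path through the given points. -/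
def pathCurve : List Space → Set Space
  | a :: b :: l => segment ℝ a b ∪ pathCurve (b :: l)
  | _ => ∅

lemma mem_pathCurve (l : List Space) (x : Space) :
    x ∈ pathCurve l ↔ ∃ (i : ℕ) (h : i + 1 < l.length), x ∈ segment ℝ l[i] l[i + 1] := by
  induction l with
  | nil => simp [pathCurve]
  | cons a l ih =>
    cases l with
    | nil => simp [pathCurve]
    | cons b l =>
      rw [pathCurve, Set.mem_union, ih]
      constructor
      · rintro (h | ⟨i, hi, h⟩)
        · exact ⟨0, by simp, h⟩
        · exact ⟨i + 1, by simpa using hi, by simpa using h⟩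
      · rintro ⟨i, hi, h⟩
        cases i with
        | zero => exact Or.inl h
        | succ i => exact Or.inr ⟨i, by simpa using hi, by simpa using h⟩

lemma pathCurve_append (l : List Space) (h : l ≠ []) (x : Space) :
    pathCurve (l ++ [x]) = pathCurve l ∪ segment ℝ (l.getLast h) x := by
  induction l with
  | nil => exact absurd rfl h
  | cons a l ih =>
    cases l with
    | nil => simp [pathCurve]
    | cons b l =>
      have := ih (by simp)
      simp only [List.cons_append] at this ⊢
      rw [pathCurve, this, pathCurve, Set.union_assoc]
      rfl

/-- The closed polygonal curve through the given points. -/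
def closedCurve (l : List Space) : Set Space := pathCurve (l ++ l.head?.toList)

lemma closedCurve_cons (b : Space) (l : List Space) :
    closedCurve (b :: l) =
      pathCurve (b :: l) ∪ segment ℝ ((b :: l).getLast (List.cons_ne_nil _ _)) b := by
  rw [← pathCurve_append]; rfl

/-- Since the starting vertex is immaterial, it is enough to describe moves at the closing edge. -/
lemma closedCurve_rotate (b : Space) (l : List Space) :
    closedCurve (l ++ [b]) = closedCurve (b :: l) := by
  cases l with
  | nil => rfl
  | cons d l =>
    have h : closedCurve (d :: l ++ [b]) = pathCurve (d :: l ++ [b]) ∪ segment ℝ b d := by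
      rw [List.cons_append, closedCurve_cons]
      simp
    rw [h]
    change _ = pathCurve (b :: d :: (l ++ [b]))
    rw [pathCurve, segment_symm, Set.union_comm]
    rfl

lemma closedCurve_eq_iUnion {n : ℕ} (v : Fin n → Space) :
    closedCurve (List.ofFn v) = ⋃ i, segment ℝ (v i) (v (finRotate n i)) := by
  cases n with
  | zero => simp [closedCurve, pathCurve]
  | succ n =>
    ext x
    rw [closedCurve, mem_pathCurve, Set.mem_iUnion]
    have hl : (List.ofFn v ++ (List.ofFn v).head?.toList).length = n + 2 := by simp
    have hs : ∀ (i : ℕ) (hi : i < n + 1) (h : i + 1 < n + 2),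
        (List.ofFn v ++ (List.ofFn v).head?.toList)[i + 1]'(by rw [hl]; exact h) =
          v (finRotate (n + 1) ⟨i, hi⟩) := by
      intro i hi h
      -- For the last index the successor is the copy of the first vertex appended by `closedCurve`.
      rcases Nat.lt_succ_iff_lt_or_eq.1 hi with h' | rfl
      · rw [List.getElem_append_left (by simpa using h'), List.getElem_ofFn,
          finRotate_of_lt h']
      · rw [List.getElem_append_right (by simp), finRotate_last']
        simp
    constructor
    · rintro ⟨i, hi, h⟩
      rw [hl] at hi
      refine ⟨⟨i, by omega⟩, ?_⟩
      rw [hs i (by omega) hi, List.getElem_append_left (by simp; omega), List.getElem_ofFn] at h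
      exact h
    · rintro ⟨⟨i, hi⟩, h⟩
      refine ⟨i, by rw [hl]; omega, ?_⟩
      rw [hs i hi (by omega), List.getElem_append_left (by simp; omega), List.getElem_ofFn]
      exact h

end PathCurve

/-! ### Certified triangle moves. -/

section Triangle

-- The same polynomials are evaluated over the integers for the tests and over the reals for the
-- geometry.
variable {R : Type*} [CommRing R]

/-- The cross product of `b - a` and `c - a`. -/
def crossVec (a b c : R × R × R) : R × R × R :=
  ((b.2.1 - a.2.1) * (c.2.2 - a.2.2) - (b.2.2 - a.2.2) * (c.2.1 - a.2.1),
    (b.2.2 - a.2.2) * (c.1 - a.1) - (b.1 - a.1) * (c.2.2 - a.2.2),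
    (b.1 - a.1) * (c.2.1 - a.2.1) - (b.2.1 - a.2.1) * (c.1 - a.1))

/-- Six times the oriented volume of a tetrahedron. -/
def volume6 (a b c d : R × R × R) : R :=
  (crossVec a b c).1 * (d.1 - a.1) + (crossVec a b c).2.1 * (d.2.1 - a.2.1) +
    (crossVec a b c).2.2 * (d.2.2 - a.2.2)

/-- A certificate that the edge `pq` of a path from `b` to `a` meets the triangle `abc` only in
`a` or `b`. -/
def EdgeAvoids (a b c p q : LatticePoint) : Prop :=
  (p = b ∧ volume6 a b c q ≠ 0) ∨ (q = a ∧ volume6 a b c p ≠ 0) ∨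
    -- Either `p` and `q` lie strictly on the same side of the plane `abc`, or two of the three
    -- volumes have opposite signs. The barycentric coordinates of a common point would be
    -- proportional to these volumes, so they could not all be nonnegative.
    0 < volume6 a b c p * volume6 a b c q ∨
    volume6 p q a b * volume6 p q b c < 0 ∨ volume6 p q b c * volume6 p q c a < 0 ∨
    volume6 p q c a * volume6 p q a b < 0

instance (a b c p q : LatticePoint) : Decidable (EdgeAvoids a b c p q) := by
  unfold EdgeAvoids; infer_instance

/-- All edges of a path avoid the triangle `abc`. -/
def PathAvoids (a b c : LatticePoint) : List LatticePoint → Prop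
  | p :: q :: l => EdgeAvoids a b c p q ∧ PathAvoids a b c (q :: l)
  | _ => True

instance PathAvoids.decidable (a b c : LatticePoint) :
    ∀ l, Decidable (PathAvoids a b c l)
  | _ :: q :: l => @instDecidableAnd _ _ inferInstance (PathAvoids.decidable a b c (q :: l))
  | [] => isTrue trivial
  | [_] => isTrue trivial

/-- A vertex `c` may be inserted into the closing edge of the polygon. -/
def CanInsert (c : LatticePoint) (l : List LatticePoint) : Prop :=
  2 ≤ l.length ∧ crossVec (l.getLastD 0) (l.headD 0) c ≠ 0 ∧
    PathAvoids (l.getLastD 0) (l.headD 0) c l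

instance (c : LatticePoint) (l : List LatticePoint) : Decidable (CanInsert c l) := by
  unfold CanInsert; infer_instance

/-- The coordinates of a point of space. -/
def coords (x : Space) : ℝ × ℝ × ℝ := (x 0, x 1, x 2)

lemma coords_toSpace (p : LatticePoint) : coords p.toSpace = (↑p.1, ↑p.2.1, ↑p.2.2) := by
  simp [coords, LatticePoint.toSpace]

lemma coords_comb (r s : ℝ) (x y : Space) : coords (r • x + s • y) = r • coords x + s • coords y := by
  simp [coords]

lemma volume6_toSpace (a b c d : LatticePoint) :
    volume6 (coords a.toSpace) (coords b.toSpace) (coords c.toSpace) (coords d.toSpace) =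
      volume6 a b c d := by
  simp only [coords_toSpace, volume6, crossVec]; push_cast; ring

lemma volume6_comb (a b c x y : ℝ × ℝ × ℝ) {r s : ℝ} (h : r + s = 1) :
    volume6 a b c (r • x + s • y) = r * volume6 a b c x + s * volume6 a b c y := by
  obtain rfl : s = 1 - r := by linarith
  simp only [volume6, crossVec, Prod.fst_add, Prod.snd_add, Prod.smul_fst, Prod.smul_snd,
    smul_eq_mul]
  ring

lemma volume6_triangle {a b c : ℝ × ℝ × ℝ} {α β γ : ℝ} (h : α + β + γ = 1) :
    volume6 a b c (α • a + β • b + γ • c) = 0 := by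
  obtain rfl : γ = 1 - α - β := by linarith
  simp only [volume6, crossVec, Prod.fst_add, Prod.snd_add, Prod.smul_fst, Prod.smul_snd,
    smul_eq_mul]
  ring

/-- If a point of the line `pq` has barycentric coordinates `α`, `β`, `γ` with respect to `abc`,
then these are proportional to the volumes spanned by `pq` and the opposite sides. -/
lemma volume6_barycentric {a b c p q : ℝ × ℝ × ℝ} {α β γ r s : ℝ} (h : α + β + γ = 1)
    (hrs : r + s = 1) (hx : α • a + β • b + γ • c = r • p + s • q) :
    β * volume6 p q a b = γ * volume6 p q c a ∧ γ * volume6 p q b c = α * volume6 p q a b ∧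
      α * volume6 p q c a = β * volume6 p q b c := by
  -- As a function of its last argument the volume is affine, and it vanishes on the line `pq`.
  -- Taking `d` to be `a`, `b`, `c` yields the three proportions.
  have hlin : ∀ d, volume6 p q d (α • a + β • b + γ • c) =
      α * volume6 p q d a + β * volume6 p q d b + γ * volume6 p q d c := by
    obtain rfl : γ = 1 - α - β := by linarith
    intro d
    simp only [volume6, crossVec, Prod.fst_add, Prod.snd_add, Prod.smul_fst, Prod.smul_snd,
      smul_eq_mul]
    ring
  have hzero : ∀ d, volume6 p q d (α • a + β • b + γ • c) = 0 := by
    obtain rfl : r = 1 - s := by linarith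
    intro d
    rw [hx]
    simp only [volume6, crossVec, Prod.fst_add, Prod.snd_add, Prod.smul_fst, Prod.smul_snd,
      smul_eq_mul]
    ring
  have hself : ∀ d, volume6 p q d d = 0 := fun d => by simp only [volume6, crossVec]; ring
  have hanti : ∀ d d', volume6 p q d d' = -volume6 p q d' d := fun d d' => by
    simp only [volume6, crossVec]; ring
  have ha := (hlin a).symm.trans (hzero a)
  have hb := (hlin b).symm.trans (hzero b)
  have hc := (hlin c).symm.trans (hzero c)
  rw [hself, hanti a c] at ha
  rw [hself, hanti b a] at hb
  rw [hself, hanti c b] at hc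
  exact ⟨by linarith, by linarith, by linarith⟩

/-- By `h2`, `α * x ^ 2 = γ * (x * y)`, with left side at least 0 and right side at most 0. Thus `γ`
and `α` vanish, then `β` by `h1`, against the sum being 1. -/
lemma no_barycentric {α β γ x y z : ℝ} (h : α + β + γ = 1) (hα : 0 ≤ α) (hγ : 0 ≤ γ)
    (h1 : β * x = γ * z) (h2 : γ * y = α * x) (hxy : x * y < 0) : False := by
  have hx : x ≠ 0 := by rintro rfl; simp at hxy
  have hy : y ≠ 0 := by rintro rfl; simp at hxy
  have e : α * (x * x) = γ * (x * y) := by linear_combination (-x) * h2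
  have hxx : 0 < x * x := mul_self_pos.2 hx
  have hγ0 : γ = 0 := by
    by_contra hne
    have : γ * (x * y) < 0 := mul_neg_of_pos_of_neg (lt_of_le_of_ne hγ (Ne.symm hne)) hxy
    nlinarith [mul_nonneg hα hxx.le]
  subst hγ0
  have hα0 : α = 0 := by simpa [hx] using h2.symm
  have hβ0 : β = 0 := by simpa [hx] using h1
  linarith

lemma exists_barycentric {a b c x : Space} (h : x ∈ convexHull ℝ {a, b, c}) :
    ∃ α β γ : ℝ, 0 ≤ α ∧ 0 ≤ β ∧ 0 ≤ γ ∧ α + β + γ = 1 ∧ x = α • a + β • b + γ • c := by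
  rw [convexHull_insert (by simp), convexHull_pair, mem_convexJoin] at h
  obtain ⟨a', ha', y, ⟨r, s, hr, hs, hrs, rfl⟩, ⟨u, v, hu, hv, huv, rfl⟩⟩ := h
  rw [Set.mem_singleton_iff] at ha'
  subst ha'
  refine ⟨u, v * r, v * s, hu, by positivity, by positivity, ?_, ?_⟩
  · rw [add_assoc, ← mul_add, hrs, mul_one, huv]
  · rw [smul_add, smul_smul, smul_smul, add_assoc]

lemma EdgeAvoids.inter_subset {a b c p q : LatticePoint} (h : EdgeAvoids a b c p q) {x : Space}
    (hx : x ∈ convexHull ℝ {a.toSpace, b.toSpace, c.toSpace})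
    (hx' : x ∈ segment ℝ p.toSpace q.toSpace) : x = a.toSpace ∨ x = b.toSpace := by
  obtain ⟨α, β, γ, hα, hβ, hγ, h1, rfl⟩ := exists_barycentric hx
  obtain ⟨r, s, hr, hs, hrs, he⟩ := hx'
  have hco : coords (α • a.toSpace + β • b.toSpace + γ • c.toSpace) =
      α • coords a.toSpace + β • coords b.toSpace + γ • coords c.toSpace := by
    simp [coords]
  have he' : α • coords a.toSpace + β • coords b.toSpace + γ • coords c.toSpace =
      r • coords p.toSpace + s • coords q.toSpace := by
    rw [← hco, ← coords_comb, he]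
  have hvol : r * ((volume6 a b c p : ℤ) : ℝ) + s * ((volume6 a b c q : ℤ) : ℝ) = 0 := by
    rw [← volume6_toSpace, ← volume6_toSpace, ← volume6_comb _ _ _ _ _ hrs, ← he',
      volume6_triangle h1]
  obtain ⟨e1, e2, e3⟩ := volume6_barycentric h1 hrs he'
  simp only [volume6_toSpace] at e1 e2 e3
  rcases h with ⟨rfl, h⟩ | ⟨rfl, h⟩ | h | h | h | h
  · right
    have h0 : volume6 a p c p = 0 := by simp only [volume6, crossVec]; ring
    have h' : ((volume6 a p c q : ℤ) : ℝ) ≠ 0 := by exact_mod_cast h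
    obtain rfl : s = 0 := by simpa [h0, h'] using hvol
    obtain rfl : r = 1 := by linarith
    rw [← he]; simp
  · left
    have h0 : volume6 q b c q = 0 := by simp only [volume6, crossVec]; ring
    have h' : ((volume6 q b c p : ℤ) : ℝ) ≠ 0 := by exact_mod_cast h
    obtain rfl : r = 0 := by simpa [h0, h'] using hvol
    obtain rfl : s = 1 := by linarith
    rw [← he]; simp
  · exfalso
    have h' : 0 < ((volume6 a b c p : ℤ) : ℝ) * ((volume6 a b c q : ℤ) : ℝ) := by exact_mod_cast h
    have hsq := mul_self_pos.2 (left_ne_zero_of_mul h'.ne')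
    -- Multiplying `hvol` by the volume at `p` turns the coefficients of `r` and `s` into positive
    -- numbers.
    have hsum : r * (((volume6 a b c p : ℤ) : ℝ) * (volume6 a b c p : ℤ)) +
        s * (((volume6 a b c p : ℤ) : ℝ) * (volume6 a b c q : ℤ)) = 0 := by
      linear_combination ((volume6 a b c p : ℤ) : ℝ) * hvol
    rcases hr.eq_or_lt with rfl | hr0
    · obtain rfl : s = 1 := by linarith
      linarith
    · linarith [mul_pos hr0 hsq, mul_nonneg hs h'.le]
  · exfalso
    have h' : ((volume6 p q a b : ℤ) : ℝ) * ((volume6 p q b c : ℤ) : ℝ) < 0 := by exact_mod_cast h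
    exact no_barycentric h1 hα hγ e1 e2 h'
  · exfalso
    have h' : ((volume6 p q b c : ℤ) : ℝ) * ((volume6 p q c a : ℤ) : ℝ) < 0 := by exact_mod_cast h
    exact no_barycentric (by linarith : β + γ + α = 1) hβ hα e2 e3 h'
  · exfalso
    have h' : ((volume6 p q c a : ℤ) : ℝ) * ((volume6 p q a b : ℤ) : ℝ) < 0 := by exact_mod_cast h
    exact no_barycentric (by linarith : γ + α + β = 1) hγ hβ e3 e1 h'

lemma PathAvoids.inter_subset {a b c : LatticePoint} :
    ∀ {l : List LatticePoint}, PathAvoids a b c l → ∀ {x : Space},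
      x ∈ convexHull ℝ {a.toSpace, b.toSpace, c.toSpace} →
      x ∈ pathCurve (l.map LatticePoint.toSpace) → x = a.toSpace ∨ x = b.toSpace
  | p :: q :: l, h, x, hx, hx' => by
    rcases hx' with hx' | hx'
    · exact h.1.inter_subset hx hx'
    · exact PathAvoids.inter_subset (l := q :: l) h.2 hx hx'
  | [], _, _, _, hx' => hx'.elim
  | [_], _, _, _, hx' => hx'.elim

lemma affineIndependent_toSpace {a b c : LatticePoint} (h : crossVec a b c ≠ 0) :
    AffineIndependent ℝ ![a.toSpace, b.toSpace, c.toSpace] := by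
  rw [affineIndependent_iff_not_collinear_set]
  intro hcol
  rw [collinear_iff_of_mem (p₀ := a.toSpace) (by simp)] at hcol
  obtain ⟨v, hv⟩ := hcol
  obtain ⟨r, hr⟩ := hv b.toSpace (by simp)
  obtain ⟨s, hs⟩ := hv c.toSpace (by simp)
  have hb : ∀ i, b.toSpace i - a.toSpace i = r * v i := fun i => by rw [hr]; simp
  have hc : ∀ i, c.toSpace i - a.toSpace i = s * v i := fun i => by rw [hs]; simp
  have hb0 := hb 0
  have hb1 := hb 1
  have hb2 := hb 2
  have hc0 := hc 0
  have hc1 := hc 1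
  have hc2 := hc 2
  simp [LatticePoint.toSpace] at hb0 hb1 hb2 hc0 hc1 hc2
  apply h
  have key : ∀ z : ℤ, (z : ℝ) = 0 → z = 0 := fun z hz => by exact_mod_cast hz
  simp only [crossVec, Prod.mk_eq_zero]
  refine ⟨key _ ?_, key _ ?_, key _ ?_⟩ <;> push_cast <;>
    simp only [hb0, hb1, hb2, hc0, hc1, hc2] <;> ring

/-- The list runs from `b` to `a`, and the closing edge `ab` is the side to be replaced. The path
meets the triangle at most in `a` and `b`; removing the segment `ab` therefore costs it only these
points, which the new sides contain. -/
lemma CanInsert.elementaryMove {c : LatticePoint} {l : List LatticePoint} (h : CanInsert c l) :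
    ElementaryMove (closedCurve (l.map LatticePoint.toSpace))
      (closedCurve ((c :: l).map LatticePoint.toSpace)) := by
  obtain ⟨h2, hne, hav⟩ := h
  cases l with
  | nil => simp at h2
  | cons b l =>
    have hlast : (b :: l).getLastD 0 = (b :: l).getLast (List.cons_ne_nil _ _) := by
      simp [List.getLastD_eq_getLast?, List.getLast?_eq_getLast_of_ne_nil]
    rw [hlast, List.headD_cons] at hne hav
    set a := (b :: l).getLast (List.cons_ne_nil _ _) with ha
    have hC : closedCurve ((b :: l).map LatticePoint.toSpace) =
        pathCurve ((b :: l).map LatticePoint.toSpace) ∪ segment ℝ a.toSpace b.toSpace := by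
      rw [List.map_cons, closedCurve_cons]
      congr 2
      rw [ha, ← List.getLast_map (f := LatticePoint.toSpace) (by simp)]
      rfl
    have hC' : closedCurve ((c :: b :: l).map LatticePoint.toSpace) =
        segment ℝ c.toSpace b.toSpace ∪ pathCurve ((b :: l).map LatticePoint.toSpace) ∪
          segment ℝ a.toSpace c.toSpace := by
      rw [List.map_cons, closedCurve_cons]
      congr 2
      rw [List.getLast_cons (by simp), ha, ← List.getLast_map (f := LatticePoint.toSpace) (by simp)]
    have hab : segment ℝ a.toSpace b.toSpace ⊆
        convexHull ℝ {a.toSpace, b.toSpace, c.toSpace} :=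
      segment_subset_convexHull (by simp) (by simp)
    refine ⟨a.toSpace, b.toSpace, c.toSpace, affineIndependent_toSpace hne, ?_, ?_⟩
    · rw [hC]
      apply Set.Subset.antisymm
      · rintro x ⟨hx, hx' | hx'⟩
        · rcases hav.inter_subset hx hx' with rfl | rfl
          · exact left_mem_segment ℝ _ _
          · exact right_mem_segment ℝ _ _
        · exact hx'
      · exact fun x hx => ⟨hab hx, Or.inr hx⟩
    · rw [hC, hC']
      apply Set.Subset.antisymm
      · rintro x ((hx | hx) | hx)
        · exact Or.inr hx
        · by_cases hx' : x ∈ segment ℝ a.toSpace b.toSpace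
          · rcases hav.inter_subset (hab hx') hx with rfl | rfl
            · exact Or.inl (Or.inr (left_mem_segment ℝ _ _))
            · exact Or.inr (right_mem_segment ℝ _ _)
          · exact Or.inl (Or.inl ⟨Or.inl hx, hx'⟩)
        · exact Or.inl (Or.inr hx)
      · rintro x ((⟨hx | hx, hx'⟩ | hx) | hx)
        · exact Or.inl (Or.inr hx)
        · exact absurd hx hx'
        · exact Or.inr hx
        · exact Or.inl (Or.inl hx)

end Triangle

/-! ### Deformations as lists of checked steps. -/

section Steps

/-- A step in the deformation of a polygon that is given by the list of its vertices. -/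
inductive Step
  /-- regard the vertex with index `k` as the first one -/
  | rotate (k : ℕ)
  /-- insert a new first vertex -/
  | insert (c : LatticePoint)
  /-- move the first vertex to a new position, and regard the second vertex as the first one -/
  | move (c : LatticePoint)

/-- The polygon after a step, provided that the step can be realized by elementary moves. -/
def Step.run : Step → List LatticePoint → Option (List LatticePoint)
  | rotate k, l => some (l.rotate k)
  | insert c, b :: l => if CanInsert c (b :: l) then some (c :: b :: l) else none
  | move c, b :: l =>
    -- After `c` is inserted before `b`, deleting `b` is the inverse of inserting it into the
    -- closing edge of `l ++ [c]`, which runs from `c` to the head of `l`.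
    if CanInsert c (b :: l) ∧ CanInsert b (l ++ [c]) then some (l ++ [c]) else none
  | _, [] => none

/-- The polygon after several steps. -/
def runSteps : List Step → List LatticePoint → Option (List LatticePoint)
  | [], l => some l
  | s :: ss, l => (s.run l).bind (runSteps ss)

lemma closedCurve_map_rotate (b : LatticePoint) (l : List LatticePoint) :
    closedCurve ((l ++ [b]).map LatticePoint.toSpace) =
      closedCurve ((b :: l).map LatticePoint.toSpace) := by
  rw [List.map_append, List.map_singleton, closedCurve_rotate, List.map_cons]

lemma closedCurve_map_listRotate (l : List LatticePoint) (k : ℕ) :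
    closedCurve ((l.rotate k).map LatticePoint.toSpace) =
      closedCurve (l.map LatticePoint.toSpace) := by
  induction k generalizing l with
  | zero => rw [List.rotate_zero]
  | succ k ih =>
    cases l with
    | nil => rw [List.rotate_nil]
    | cons b l => rw [List.rotate_cons_succ, ih, closedCurve_map_rotate]

lemma Step.eqvGen_of_run {s : Step} {l l' : List LatticePoint} (h : s.run l = some l') :
    Relation.EqvGen ElementaryMove (closedCurve (l.map LatticePoint.toSpace))
      (closedCurve (l'.map LatticePoint.toSpace)) := by
  match s, l, h with
  | rotate k, l, h =>
    obtain rfl : l.rotate k = l' := by simpa [Step.run] using h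
    rw [closedCurve_map_listRotate]
    exact .refl _
  | insert c, b :: l, h =>
    simp only [Step.run, Option.ite_none_right_eq_some, Option.some.injEq] at h
    obtain ⟨hc, rfl⟩ := h
    exact .rel _ _ hc.elementaryMove
  | move c, b :: l, h =>
    simp only [Step.run, Option.ite_none_right_eq_some, Option.some.injEq] at h
    obtain ⟨⟨hc, hb⟩, rfl⟩ := h
    refine (Relation.EqvGen.rel _ _ hc.elementaryMove).trans _ _ _ ?_
    have := (Relation.EqvGen.rel _ _ hb.elementaryMove).symm
    rwa [← List.cons_append, closedCurve_map_rotate] at this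

lemma eqvGen_of_runSteps {ss : List Step} {l l' : List LatticePoint}
    (h : runSteps ss l = some l') :
    Relation.EqvGen ElementaryMove (closedCurve (l.map LatticePoint.toSpace))
      (closedCurve (l'.map LatticePoint.toSpace)) := by
  induction ss generalizing l with
  | nil =>
    obtain rfl : l = l' := by simpa [runSteps] using h
    exact .refl _
  | cons s ss ih =>
    obtain ⟨m, hm, h⟩ := Option.bind_eq_some_iff.1 h
    exact (Step.eqvGen_of_run hm).trans _ _ _ (ih h)

end Steps

/-! ### From lattice data to bounds on both stick numbers. -/

lemma latticeKnot_curve {l : List LatticePoint} (hn : 3 ≤ l.length) (h : SimpleShadow l.get) :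
    (latticeKnot l.get hn h).curve = closedCurve (l.map LatticePoint.toSpace) := by
  have : l.map LatticePoint.toSpace = List.ofFn fun i => (l.get i).toSpace := by
    rw [← Function.comp_def, ← List.map_ofFn, List.ofFn_get]
  rw [this, closedCurve_eq_iUnion]
  rfl

/-- The pairs of edges in a list, numbered from `1`. -/
def edgePairs {n : ℕ} (hn : 0 < n) (E : List (ℕ × ℕ)) (l : ℕ) : Fin n × Fin n :=
  -- Label `l` has list index `l - 1`. The default value and the reduction modulo `n` only make the
  -- function total: the tables below contain valid edge indices.
  (⟨(E.getD (l - 1) 0).1 % n, Nat.mod_lt _ hn⟩, ⟨(E.getD (l - 1) 0).2 % n, Nat.mod_lt _ hn⟩)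

/-- An equilateral lattice polygon that is deformed by elementary moves into a polygon with a given
Dowker–Thistlethwaite code bounds both stick numbers. -/
theorem stickNumber_le_of_lattice {c : List ℤ} (k : List LatticePoint) (ss : List Step)
    (l : List LatticePoint) (E : List (ℕ × ℕ)) (q : ℤ)
    (hk : 3 ≤ k.length) (hl : 3 ≤ l.length) (hks : SimpleShadow k.get) (hq : HasSqLength k.get q)
    (hss : runSteps ss k = some l) (hls : SimpleShadow l.get) 
    (hc : IntegralDTCode l.get c (edgePairs (by omega) E)) :
    stickNumber (knotOfDTCode c) ≤ k.length ∧ eqStickNumber (knotOfDTCode c) ≤ k.length := by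
  have hmem : latticeKnot k.get hk hks ∈ knotOfDTCode c := by
    refine ⟨latticeKnot l.get hl hls, ?_, hc.hasDTCode hl hls⟩
    rw [PolygonalKnot.Equivalent, latticeKnot_curve, latticeKnot_curve]
    exact eqvGen_of_runSteps hss
  exact ⟨iInf₂_le (latticeKnot k.get hk hks) hmem,
    iInf₂_le (latticeKnot k.get hk hks) ⟨hmem, latticeKnot_isEquilateral hk hks hq⟩⟩


/-! ### The polygons, deformations and crossing tables of the twelve knots. -/

lemma stickNumber_9_18_le :
    stickNumber knot_9_18 ≤ 10 ∧ eqStickNumber knot_9_18 ≤ 10 :=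
  stickNumber_le_of_lattice
    [(316, -3127, 5111), (0, 0, 0), (3600, -1155, 4659), (-1368, -1854, 1368), (155, -2683, 7112),
     (-3541, -2254, 2405), (2158, -450, 1888), (-2418, 1241, 5381), (41, -2244, 1161),
     (-4836, -248, 4030)]
    -- The projection of the short polygon already has the required code, so the same vertices
    -- appear twice.
    []
    [(316, -3127, 5111), (0, 0, 0), (3600, -1155, 4659), (-1368, -1854, 1368), (155, -2683, 7112),
     (-3541, -2254, 2405), (2158, -450, 1888), (-2418, 1241, 5381), (41, -2244, 1161),
     (-4836, -248, 4030)]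
    [(0, 2), (0, 5), (1, 5), (2, 0), (2, 7), (2, 8), (4, 9), (5, 9), (5, 8), (5, 7), (5, 0),
     (5, 1), (7, 5), (7, 2), (8, 2), (8, 5), (9, 5), (9, 4)]
    -- All edges are integral vectors on one sphere of radius slightly above 6000.
    36000306 (by decide) (by decide) (by decide +kernel) (by decide +kernel) (by decide +kernel)
    (by decide +kernel) (by decide +kernel)

lemma stickNumber_10_18_le :
    stickNumber knot_10_18 ≤ 10 ∧ eqStickNumber knot_10_18 ≤ 10 :=
  stickNumber_le_of_lattice
    [(-407, -691, 62), (1909, -2068, -5299), (0, 0, 0), (5071, 1048, -3031), (1672, -2945, -115),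
     (1097, -829, -5700), (3222, 891, -359), (-1723, -68, -3619), (2361, -2943, -294),
     (3885, 2208, -2967)]
    -- The new vertex lies close to the closing edge, between two of its crossings: the numbering of
    -- the passages has to start inside that edge.
    [.insert (772, 111, -772)]
    [(772, 111, -772), (-407, -691, 62), (1909, -2068, -5299), (0, 0, 0), (5071, 1048, -3031),
     (1672, -2945, -115), (1097, -829, -5700), (3222, 891, -359), (-1723, -68, -3619),
     (2361, -2943, -294), (3885, 2208, -2967)]
    [(0, 2), (1, 5), (2, 5), (2, 0), (3, 10), (3, 6), (3, 9), (4, 9), (4, 8), (5, 8), (5, 1),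
     (5, 2), (6, 3), (7, 10), (8, 5), (8, 4), (9, 4), (9, 3), (10, 7), (10, 3)]
    36000306 (by decide) (by decide) (by decide +kernel) (by decide +kernel) (by decide +kernel)
    (by decide +kernel) (by decide +kernel)

lemma stickNumber_10_68_le :
    stickNumber knot_10_68 ≤ 10 ∧ eqStickNumber knot_10_68 ≤ 10 :=
  stickNumber_le_of_lattice
    [(2901, 843, -5184), (0, 0, 0), (1205, -1835, -5584), (1816, 2481, -1461),
     (4668, -988, -5440), (864, -2689, -1123), (1300, -338, -6626), (4560, 1497, -1935),
     (-824, 406, -4348), (2340, -3573, -1161)]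
    []
    [(2901, 843, -5184), (0, 0, 0), (1205, -1835, -5584), (1816, 2481, -1461),
     (4668, -988, -5440), (864, -2689, -1123), (1300, -338, -6626), (4560, 1497, -1935),
     (-824, 406, -4348), (2340, -3573, -1161)]
    [(0, 2), (1, 5), (2, 6), (2, 0), (2, 7), (3, 7), (3, 6), (4, 9), (4, 8), (5, 8), (5, 1),
     (6, 2), (6, 9), (6, 3), (7, 3), (7, 2), (8, 5), (8, 4), (9, 4), (9, 6)]
    36000306 (by decide) (by decide) (by decide +kernel) (by decide +kernel) (by decide +kernel)
    (by decide +kernel) (by decide +kernel)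

lemma stickNumber_10_82_le :
    stickNumber knot_10_82 ≤ 10 ∧ eqStickNumber knot_10_82 ≤ 10 :=
  stickNumber_le_of_lattice
    [(0, 0, 0), (-2723, 3176, -4301), (1358, 2695, 71), (-1851, -1225, -3144),
     (-1355, 4726, -2561), (3754, 1906, -3956), (-677, 1714, 85), (-2154, -937, -5091),
     (-3135, 3971, -1782), (2416, 3715, -4045)]
    []
    [(0, 0, 0), (-2723, 3176, -4301), (1358, 2695, 71), (-1851, -1225, -3144),
     (-1355, 4726, -2561), (3754, 1906, -3956), (-677, 1714, 85), (-2154, -937, -5091),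
     (-3135, 3971, -1782), (2416, 3715, -4045)]
    [(0, 2), (0, 6), (0, 3), (1, 3), (2, 5), (2, 0), (3, 6), (3, 0), (3, 1), (3, 8), (4, 8),
     (4, 9), (5, 9), (5, 2), (6, 0), (6, 3), (8, 3), (8, 4), (9, 4), (9, 5)]
    36000306 (by decide) (by decide) (by decide +kernel) (by decide +kernel) (by decide +kernel)
    (by decide +kernel) (by decide +kernel)

lemma stickNumber_10_84_le :
    stickNumber knot_10_84 ≤ 10 ∧ eqStickNumber knot_10_84 ≤ 10 :=
  stickNumber_le_of_lattice
    [(3587, -493, 537), (-2273, -768, 1796), (998, 1016, -2907), (-1859, 1057, 2369),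
     (-968, -3170, -1795), (1465, 634, 2156), (-1171, -13, -3195), (2445, 2194, 1054),
     (-963, -2705, 1675), (-1260, 2251, -1694)]
    -- Additional vertices give room for the moves that lead to a diagram with the ten crossings of
    -- the code. The last insertion again only places the start of the numbering inside an edge.
    [.insert (1506, 706, -425), .rotate 8, .insert (-382, 448, -2329), .rotate 7,
     .insert (-288, 330, -1125), .rotate 6, .insert (-905, 146, -2889), .rotate 4,
     .insert (-1169, 1122, -887), .rotate 1, .move (-2309, 2011, -1423), .move (-178, 2747, 175),
     .rotate 12, .move (-855, -1289, -3342), .rotate 10, .move (-384, 1990, -1520), .rotate 1,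
     .move (2485, 1957, 775), .move (-1082, -1883, 3056), .rotate 3, .move (2459, -934, 1531),
     .rotate 1, .move (-964, 59, -1302), .rotate 6, .move (-1144, 120, -953), .rotate 8,
     .move (24, 1033, -2186), .rotate 2, .move (1393, 1066, 2625), .rotate 9,
     .move (-3780, -1285, 744), .rotate 13, .move (1451, -1845, 1173), .rotate 9,
     .move (2356, 2865, -835), .rotate 9, .move (-951, -2905, -2890), .move (1022, 611, 3871),
     .rotate 7, .move (733, 3571, -1198), .rotate 7, .move (350, 1229, -3803), .rotate 9,
     .move (-389, 1309, -3030), .rotate 1, .move (-1585, -198, 137), .rotate 11,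
     .move (-2317, -304, 757), .rotate 11, .move (-3818, -1394, -137), .rotate 12,
     .move (-398, -1844, 1952), .rotate 10, .move (619, 855, -2621), .rotate 1,
     .move (-427, -451, -1773), .rotate 6, .insert (-57, -1229, 1007)]
    [(-57, -1229, 1007), (-2317, -304, 757), (-389, 1309, -3030), (24, 1033, -2186),
     (-1585, -198, 137), (-951, -2905, -2890), (1022, 611, 3871), (619, 855, -2621),
     (-384, 1990, -1520), (-427, -451, -1773), (2356, 2865, -835), (-398, -1844, 1952),
     (-855, -1289, -3342), (-3818, -1394, -137), (733, 3571, -1198), (1451, -1845, 1173)]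
    [(0, 4), (1, 8), (3, 8), (4, 0), (4, 12), (5, 15), (5, 10), (6, 9), (8, 1), (8, 3), (9, 6),
     (9, 14), (10, 14), (10, 5), (10, 15), (12, 4), (14, 9), (14, 10), (15, 5), (15, 10)]
    36000306 (by decide) (by decide) (by decide +kernel) (by decide +kernel) (by decide +kernel)
    (by decide +kernel) (by decide +kernel)

lemma stickNumber_10_93_le :
    stickNumber knot_10_93 ≤ 10 ∧ eqStickNumber knot_10_93 ≤ 10 :=
  stickNumber_le_of_lattice
    [(-2620, -5365, -1975), (1555, -2525, -5216), (0, 0, 0), (-817, -2416, -5431),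
     (432, -6464, -1182), (456, -3017, -6093), (3363, -1133, -1194), (200, -4624, -4910),
     (285, 67, -1170), (2841, -4394, -4263)]
    []
    [(-2620, -5365, -1975), (1555, -2525, -5216), (0, 0, 0), (-817, -2416, -5431),
     (432, -6464, -1182), (456, -3017, -6093), (3363, -1133, -1194), (200, -4624, -4910),
     (285, 67, -1170), (2841, -4394, -4263)]
    [(0, 3), (0, 7), (0, 4), (1, 5), (1, 7), (3, 0), (3, 9), (4, 9), (4, 6), (4, 0), (5, 1),
     (5, 8), (6, 8), (6, 4), (7, 0), (7, 1), (8, 5), (8, 6), (9, 4), (9, 3)]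
    36000306 (by decide) (by decide) (by decide +kernel) (by decide +kernel) (by decide +kernel)
    (by decide +kernel) (by decide +kernel)

lemma stickNumber_10_100_le :
    stickNumber knot_10_100 ≤ 10 ∧ eqStickNumber knot_10_100 ≤ 10 :=
  stickNumber_le_of_lattice
    [(2709, -2328, 4821), (5840, 1696, 1658), (1379, -797, 4802), (5070, -4357, 1687),
     (4922, 1594, 2438), (-177, -1497, 1770), (5264, -3493, 3323), (6213, 471, -1080),
     (4008, -189, 4461), (0, 0, 0)]
    []
    [(2709, -2328, 4821), (5840, 1696, 1658), (1379, -797, 4802), (5070, -4357, 1687),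
     (4922, 1594, 2438), (-177, -1497, 1770), (5264, -3493, 3323), (6213, 471, -1080),
     (4008, -189, 4461), (0, 0, 0)]
    [(0, 2), (0, 7), (0, 3), (1, 3), (1, 8), (2, 0), (2, 5), (3, 5), (3, 7), (3, 0), (3, 1),
     (4, 8), (4, 9), (5, 2), (5, 3), (7, 3), (7, 0), (8, 1), (8, 4), (9, 4)]
    36000306 (by decide) (by decide) (by decide +kernel) (by decide +kernel) (by decide +kernel)
    (by decide +kernel) (by decide +kernel)

/-- Signs of both kinds occur in the code, so the diagram is not alternating. The code is read off
from a polygon with twelve edges, reached after two insertions and a sequence of vertex moves. -/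
lemma stickNumber_10_152_le :
    stickNumber knot_10_152 ≤ 10 ∧ eqStickNumber knot_10_152 ≤ 10 :=
  stickNumber_le_of_lattice
    [(659, 2128, 2472), (423, -21, -3125), (-506, -1609, 2586), (509, 1350, -2534),
     (-195, -3457, 987), (-1154, 2455, 628), (762, -3186, -85), (-2954, 1517, -356),
     (2487, 1588, 2172), (-32, -763, -2740)]
    [.insert (279, 430, -528), .insert (175, -65, -1409), .rotate 4, .move (-527, -1065, 2300),
     .rotate 7, .move (-304, 1084, -2733), .rotate 5, .move (-496, -3425, 1076), .rotate 6,
     .move (786, -2167, 3417), .rotate 9, .move (530, -520, -3099), .rotate 5,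
     .move (226, 373, -1642), .rotate 11, .move (1014, 203, -1505), .rotate 2,
     .move (1067, -3043, -696), .rotate 1, .move (1758, 426, 2057), .rotate 10,
     .move (-2708, 819, -1433), .rotate 5, .move (459, 242, -3043), .rotate 10,
     .move (1380, 764, 3049), .rotate 9, .move (399, 1024, -3796), .rotate 10,
     .move (2898, -2222, -1471), .rotate 7, .move (-940, 3232, -61), .rotate 8,
     .move (-770, 732, 1336), .move (1104, 18, -2233), .move (-1778, -1885, 2662), .rotate 1,
     .move (682, -3236, 824), .rotate 5, .move (3244, 424, 905), .rotate 7,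
     .move (1240, 2202, 1473), .rotate 10, .move (-3025, -606, -322), .move (395, 2598, 454),
     .rotate 4, .move (659, 119, -3711), .rotate 10, .move (2809, -187, 2074), .rotate 3,
     .move (-1176, -820, 620), .rotate 8, .move (611, 354, -3887), .rotate 7,
     .move (1984, -905, -2182), .rotate 10]
    [(395, 2598, 454), (1984, -905, -2182), (399, 1024, -3796), (786, -2167, 3417),
     (2809, -187, 2074), (611, 354, -3887), (-770, 732, 1336), (1104, 18, -2233),
     (-1176, -820, 620), (-940, 3232, -61), (682, -3236, 824), (-3025, -606, -322)]
    [(0, 4), (1, 4), (2, 5), (2, 6), (2, 7), (4, 0), (4, 1), (5, 2), (5, 9), (6, 9), (6, 2),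
     (7, 2), (7, 9), (8, 11), (9, 11), (9, 5), (9, 6), (9, 7), (11, 8), (11, 9)]
    36000306 (by decide) (by decide) (by decide +kernel) (by decide +kernel) (by decide +kernel)
    (by decide +kernel) (by decide +kernel)

lemma stickNumber_10_58_le :
    stickNumber knot_10_58 ≤ 11 ∧ eqStickNumber knot_10_58 ≤ 11 :=
  stickNumber_le_of_lattice
    [(1802, -2537, 4529), (-1093, -3146, -691), (-158, -330, 4524), (5759, -154, 3545),
     (323, -2653, 3998), (3911, 2156, 4007), (0, 0, 0), (1961, -169, 5668), (-2268, -1326, 1572),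
     (3008, 1531, 1613), (-2737, -185, 1388)]
    -- A vertex near the closing edge, which only fixes where the numbering starts.
    [.insert (-1038, -1073, 2564)]
    [(-1038, -1073, 2564), (1802, -2537, 4529), (-1093, -3146, -691), (-158, -330, 4524),
     (5759, -154, 3545), (323, -2653, 3998), (3911, 2156, 4007), (0, 0, 0), (1961, -169, 5668),
     (-2268, -1326, 1572), (3008, 1531, 1613), (-2737, -185, 1388)]
    [(0, 2), (0, 5), (0, 4), (2, 0), (2, 8), (3, 8), (3, 5), (4, 0), (5, 0), (5, 3), (6, 10),
     (7, 9), (8, 3), (8, 2), (8, 11), (9, 11), (9, 7), (10, 6), (11, 9), (11, 8)]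
    36000306 (by decide) (by decide) (by decide +kernel) (by decide +kernel) (by decide +kernel)
    (by decide +kernel) (by decide +kernel)

lemma stickNumber_10_66_le :
    stickNumber knot_10_66 ≤ 11 ∧ eqStickNumber knot_10_66 ≤ 11 :=
  stickNumber_le_of_lattice
    [(3913, -689, -4496), (0, 0, 0), (1415, 415, -5816), (-1018, -4616, -3632), (698, 115, -365),
     (-2675, -906, -5221), (-90, 3574, -2180), (37, -2395, -1584), (854, -399, -7183),
     (130, -4196, -2594), (-819, 1652, -1645)]
    []
    [(3913, -689, -4496), (0, 0, 0), (1415, 415, -5816), (-1018, -4616, -3632), (698, 115, -365),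
     (-2675, -906, -5221), (-90, 3574, -2180), (37, -2395, -1584), (854, -399, -7183),
     (130, -4196, -2594), (-819, 1652, -1645)]
    [(0, 2), (0, 3), (0, 4), (2, 0), (2, 8), (2, 9), (3, 9), (3, 6), (3, 0), (4, 0), (4, 6),
     (4, 9), (6, 10), (6, 4), (6, 3), (8, 2), (9, 2), (9, 3), (9, 4), (10, 6)]
    36000306 (by decide) (by decide) (by decide +kernel) (by decide +kernel) (by decide +kernel)
    (by decide +kernel) (by decide +kernel)

lemma stickNumber_10_79_le :
    stickNumber knot_10_79 ≤ 11 ∧ eqStickNumber knot_10_79 ≤ 11 :=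
  stickNumber_le_of_lattice
    [(-2307, -3924, 3909), (0, 0, 0), (3396, -2007, 4521), (1313, -6203, 772),
     (-2403, -3040, 4263), (-334, -2688, -1358), (2147, -96, 3451), (1996, -4489, -633),
     (-1319, -3373, 4242), (-1242, -2537, -1699), (3169, -2041, 2338)]
    -- Again a starting point inside the closing edge.
    [.insert (-1080, -3508, 3552)]
    [(-1080, -3508, 3552), (-2307, -3924, 3909), (0, 0, 0), (3396, -2007, 4521),
     (1313, -6203, 772), (-2403, -3040, 4263), (-334, -2688, -1358), (2147, -96, 3451),
     (1996, -4489, -633), (-1319, -3373, 4242), (-1242, -2537, -1699), (3169, -2041, 2338)]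
    [(0, 4), (1, 4), (1, 5), (2, 6), (2, 7), (4, 0), (4, 1), (5, 1), (5, 9), (6, 10), (6, 2),
     (7, 2), (7, 10), (7, 11), (8, 11), (9, 5), (10, 6), (10, 7), (11, 7), (11, 8)]
    36000306 (by decide) (by decide) (by decide +kernel) (by decide +kernel) (by decide +kernel)
    (by decide +kernel) (by decide +kernel)

lemma stickNumber_10_80_le :
    stickNumber knot_10_80 ≤ 11 ∧ eqStickNumber knot_10_80 ≤ 11 :=
  stickNumber_le_of_lattice
    [(0, 0, 0), (-1756, 5707, 589), (1145, 691, 2146), (36, -642, -3598), (-1213, 3406, 651),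
     (4598, 2929, -765), (829, 1757, 3754), (153, 2838, -2109), (4050, 4029, 2295),
     (594, -312, 12), (1801, 2897, 4936)]
    [.insert (1120, 1808, 3089)]
    [(1120, 1808, 3089), (0, 0, 0), (-1756, 5707, 589), (1145, 691, 2146), (36, -642, -3598),
     (-1213, 3406, 651), (4598, 2929, -765), (829, 1757, 3754), (153, 2838, -2109),
     (4050, 4029, 2295), (594, -312, 12), (1801, 2897, 4936)]
    [(0, 2), (1, 5), (2, 5), (2, 0), (2, 10), (3, 10), (5, 1), (5, 2), (5, 8), (5, 9), (6, 9),
     (6, 10), (6, 11), (8, 5), (9, 5), (9, 6), (10, 3), (10, 2), (10, 6), (11, 6)]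
    36000306 (by decide) (by decide) (by decide +kernel) (by decide +kernel) (by decide +kernel)
    (by decide +kernel) (by decide +kernel)

end StickKnot

theorem theorem1 :
    (∀ T ∈ [StickKnot.knot_9_18, StickKnot.knot_10_18, StickKnot.knot_10_68,
        StickKnot.knot_10_82, StickKnot.knot_10_84, StickKnot.knot_10_93,
        StickKnot.knot_10_100, StickKnot.knot_10_152],
      StickKnot.stickNumber T ≤ 10 ∧ StickKnot.eqStickNumber T ≤ 10) ∧
    (∀ T ∈ [StickKnot.knot_10_58, StickKnot.knot_10_66, StickKnot.knot_10_79,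
        StickKnot.knot_10_80],
      StickKnot.stickNumber T ≤ 11 ∧ StickKnot.eqStickNumber T ≤ 11) := by
  simp only [List.forall_mem_cons, List.not_mem_nil, false_imp_iff, implies_true, and_true]
  exact ⟨⟨StickKnot.stickNumber_9_18_le, StickKnot.stickNumber_10_18_le,
      StickKnot.stickNumber_10_68_le, StickKnot.stickNumber_10_82_le,
      StickKnot.stickNumber_10_84_le, StickKnot.stickNumber_10_93_le,
      StickKnot.stickNumber_10_100_le, StickKnot.stickNumber_10_152_le⟩,
    StickKnot.stickNumber_10_58_le, StickKnot.stickNumber_10_66_le,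
    StickKnot.stickNumber_10_79_le, StickKnot.stickNumber_10_80_le⟩
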